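/- Let $n\ge 0$ and $\pi\in S_n$; write $\pi$ also for the $n\times n$ matrix with entry $1$ at $(i,j)$ if $\pi(j)=i$ and $0$ otherwise. Let $B_-$ and $B_+$ be the groups of invertible lower and upper triangular complex $n\times n$ matrices, and let the matrix Schubert variety $\overline{X_\pi}\subset\mathbb{C}^{n\times n}$ be the Zariski closure of $B_-\pi B_+=\{X\pi Y^{-1}: X\in B_-,\ Y\in B_+\}$. Let $D(\pi)=\{(\pi(j),i): i<j,\ \pi(i)>\pi(j)\}$ be the Rothe diagram (boxes are written (row, column)), let $\mathrm{dom}(\pi)$ be the connected component of $D(\pi)$ (boxes being adjacent if they share a side) containing the north-west corner box $(1,1)$ (empty if $(1,1)\notin D(\pi)$), let $NW(\pi)$ be the set of boxes weakly north-west of some box of $D(\pi)$, and put $L(\pi)=NW(\pi)\setminus\mathrm{dom}(\pi)$ and $L'(\pi)=L(\pi)\setminus D(\pi)$. Let $Y_\pi\subset\mathbb{C}^{L(\pi)}$ be the projection of $\overline{X_\pi}$ onto the entries inside $L(\pi)$. Let $T^n$ be the group of invertible diagonal matrices. $T^{2n}=T^n\times T^n$ acts on matrices by $(A,B)\cdot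 M=AMB^{-1}$, hence on $\mathbb{C}^{L(\pi)}$ by scaling the $(i,j)$ entry by $A_{ii}B_{jj}^{-1}$, and this induces an action of $T^{2n-1}:=T^{2n}/\{(aI,aI): a\in\mathbb{C}^*\}$. Call $Y_\pi$ a toric variety with respect to the $T^{2n-1}$-action if it is an irreducible Zariski closed subset of $\mathbb{C}^{L(\pi)}$, invariant under $T^{2n-1}$, with a Zariski dense $T^{2n-1}$-orbit. A hook is a set of boxes consisting of a corner box $(i,j)$, a (possibly empty) run of consecutive boxes of row $i$ immediately to the right of it and a (possibly empty) run of consecutive boxes of column $j$ immediately below it. Then $Y_\pi$ is a toric variety with respect to the $T^{2n-1}$-action if and only if $L'(\pi)$ is a (possibly empty) union of pairwise disjoint hooks, no two of which share a row or a column. -/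

import Mathlib

namespace MatrixSchubert

noncomputable section

/-! ### Combinatorics of boxes

A box of the `n × n` grid is a pair (row, column); rows are numbered from top to bottom and columns
from left to right, starting with `0`. -/

/-- The boxes of the `n × n` grid. -/
abbrev Box (n : ℕ) : Type := Fin n × Fin n

/-- The permutation matrix of `π`: the entry in row `i` and column `j` is `1` iff `π j = i`. -/
def permutationMatrix {n : ℕ} (π : Equiv.Perm (Fin n)) : Matrix (Fin n) (Fin n) ℂ :=
  Matrix.of fun i j => if π j = i then 1 else 0

/-- The Rothe diagram `D(π) = {(π j, i) : i < j, π i > π j}`. -/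
def diagram {n : ℕ} (π : Equiv.Perm (Fin n)) : Set (Box n) :=
  {b | ∃ i j : Fin n, i < j ∧ π j < π i ∧ b = (π j, i)}

/-- The grid graph: two boxes are adjacent iff they share a side. -/
def grid (n : ℕ) : SimpleGraph (Box n) :=
  SimpleGraph.boxProd (SimpleGraph.pathGraph n) (SimpleGraph.pathGraph n)

/-- The dominant piece `dom(π)`: the connected component of the diagram that contains the north-west
corner box of the grid (empty if that box is not in the diagram). -/
def dominantPiece {n : ℕ} (π : Equiv.Perm (Fin n)) : Set (Box n) :=
  {b | ∃ (a : Box n) (ha : a ∈ diagram π) (hb : b ∈ diagram π),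
    a.1.val = 0 ∧ a.2.val = 0 ∧ ((grid n).induce (diagram π)).Reachable ⟨a, ha⟩ ⟨b, hb⟩}

/-- `NW(π)`: the boxes weakly north-west of some box of the diagram. -/
def northWest {n : ℕ} (π : Equiv.Perm (Fin n)) : Set (Box n) :=
  {b | ∃ d ∈ diagram π, b.1 ≤ d.1 ∧ b.2 ≤ d.2}

/-- `L(π) = NW(π) - dom(π)`. -/
def regionL {n : ℕ} (π : Equiv.Perm (Fin n)) : Set (Box n) :=
  northWest π \ dominantPiece π

/-- `L'(π) = L(π) - D(π)`. -/
def regionL' {n : ℕ} (π : Equiv.Perm (Fin n)) : Set (Box n) :=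
  regionL π \ diagram π

/-- A hook: a corner box `(i, j)`, the boxes `(i, j), …, (i, j')` to the right of it (the arm) and
the boxes `(i, j), …, (i', j)` below it (the leg); the arm and the leg may consist of the corner
only. -/
def IsHook {n : ℕ} (H : Set (Box n)) : Prop :=
  ∃ i i' j j' : Fin n, i ≤ i' ∧ j ≤ j' ∧
    H = {b | b.1 = i ∧ j ≤ b.2 ∧ b.2 ≤ j'} ∪ {b | b.2 = j ∧ i ≤ b.1 ∧ b.1 ≤ i'}

/-- Two sets of boxes have no row and no column in common. -/
def NoCommonLine {n : ℕ} (H K : Set (Box n)) : Prop :=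
  ∀ b ∈ H, ∀ c ∈ K, b.1 ≠ c.1 ∧ b.2 ≠ c.2

/-- `S` is a union of (possibly zero) pairwise disjoint hooks, no two of which share a row or a
column. -/
def IsUnionOfSeparatedHooks {n : ℕ} (S : Set (Box n)) : Prop :=
  ∃ 𝓗 : Set (Set (Box n)), (∀ H ∈ 𝓗, IsHook H) ∧ 𝓗.Pairwise Disjoint ∧
    𝓗.Pairwise NoCommonLine ∧ S = ⋃₀ 𝓗

/-! ### Matrix Schubert varieties -/

/-- The Zariski closure of a subset of the affine space `ℂ^σ`: the common zeros of all polynomials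
that vanish on it. -/
def zariskiClosure {σ : Type} (S : Set (σ → ℂ)) : Set (σ → ℂ) :=
  MvPolynomial.zeroLocus ℂ (MvPolynomial.vanishingIdeal ℂ S)

/-- The orbit `B₋ π B₊` under `(X, Y) · M = X M Y⁻¹`, where `X` is an invertible lower triangular
and `Y` an invertible upper triangular matrix. -/
def borelOrbit {n : ℕ} (π : Equiv.Perm (Fin n)) : Set (Matrix (Fin n) (Fin n) ℂ) :=
  {M | ∃ X Y : GL (Fin n) ℂ, (∀ i j, i < j → X.val i j = 0) ∧ (∀ i j, j < i → Y.val i j = 0) ∧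
    M = X.val * permutationMatrix π * (Y⁻¹).val}

/-- The matrix Schubert variety of `π`: the Zariski closure of `B₋ π B₊` in the space of all
`n × n` matrices, a matrix being regarded as the point of `ℂ^(n × n)` of its entries. -/
def matrixSchubertVariety {n : ℕ} (π : Equiv.Perm (Fin n)) : Set (Box n → ℂ) :=
  zariskiClosure ((fun M b => M b.1 b.2) '' borelOrbit π)

/-- `Y_π`: the projection of the matrix Schubert variety onto the entries inside `L(π)`. -/
def varietyY {n : ℕ} (π : Equiv.Perm (Fin n)) : Set (regionL π → ℂ) :=
  (fun (x : Box n → ℂ) (b : regionL π) => x b) '' matrixSchubertVariety π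

/-! ### The torus action and toric varieties -/

/-- The torus `T^(2n)` of pairs of invertible diagonal `n × n` matrices, each given by its diagonal
entries. -/
abbrev Torus (n : ℕ) : Type := (Fin n → ℂˣ) × (Fin n → ℂˣ)

/-- The stabilizer `{(a I, a I) : a ∈ ℂ^*}`. -/
def scalars (n : ℕ) : Subgroup (Torus n) where
  carrier := {t | ∃ a : ℂˣ, t = (fun _ => a, fun _ => a)}
  one_mem' := ⟨1, rfl⟩
  mul_mem' := by
    rintro _ _ ⟨a, rfl⟩ ⟨b, rfl⟩
    exact ⟨a * b, rfl⟩
  inv_mem' := by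
    rintro _ ⟨a, rfl⟩
    exact ⟨a⁻¹, rfl⟩

/-- The quotient torus `T^(2n-1) = T^(2n) / {(a I, a I)}`. -/
abbrev QuotientTorus (n : ℕ) : Type := Torus n ⧸ scalars n

/-- The action `(A, B) · M = A M B⁻¹` of `T^(2n)` on the entries in the set `S` of boxes: the entry
in row `i` and column `j` is multiplied by `a i * (b j)⁻¹`. -/
def torusAction {n : ℕ} (S : Set (Box n)) : Torus n →* Equiv.Perm (S → ℂ) where
  toFun t :=
    { toFun := fun x b => (t.1 b.1.1 * (t.2 b.1.2)⁻¹ : ℂˣ) * x b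
      invFun := fun x b => ((t.1 b.1.1 * (t.2 b.1.2)⁻¹)⁻¹ : ℂˣ) * x b
      left_inv := fun x => by funext b; exact Units.inv_mul_cancel_left _ _
      right_inv := fun x => by funext b; exact Units.mul_inv_cancel_left _ _ }
  map_one' := by
    ext x b
    simp
  map_mul' s t := by
    ext x b
    simp only [Equiv.Perm.mul_apply, Equiv.coe_fn_mk, Prod.fst_mul, Prod.snd_mul, Pi.mul_apply,
      mul_inv, Units.val_mul]
    ring

theorem scalars_le_ker {n : ℕ} (S : Set (Box n)) : scalars n ≤ (torusAction S).ker := by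
  rintro _ ⟨a, rfl⟩
  rw [MonoidHom.mem_ker]
  ext x b
  simp [torusAction]

/-- The action of `T^(2n-1)` on the entries in `S` that is induced by the action of `T^(2n)`. -/
def quotientTorusAction {n : ℕ} (S : Set (Box n)) : QuotientTorus n →* Equiv.Perm (S → ℂ) :=
  QuotientGroup.lift (scalars n) (torusAction S) (scalars_le_ker S)

/-- `Y` is a toric variety with respect to the action of `T^(2n-1)`: it is an irreducible Zariski
closed set (the polynomials vanishing on it form a prime ideal, that is, the constant `1` is not
among them and a product is only if one of the factors is), it is invariant, and it has a Zariski
dense orbit. -/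
structure IsToric {n : ℕ} {S : Set (Box n)} (Y : Set (S → ℂ)) : Prop where
  closed : zariskiClosure Y = Y
  irreducible : (MvPolynomial.vanishingIdeal ℂ Y).IsPrime
  invariant : ∀ t : QuotientTorus n, ∀ y ∈ Y, quotientTorusAction S t y ∈ Y
  dense_orbit : ∃ p ∈ Y, Y ⊆ zariskiClosure (Set.range fun t => quotientTorusAction S t p)

end

end MatrixSchubert

namespace MatrixSchubert

/-! ### Combinatorics of the Rothe diagram -/

/-! Put a dot at each `(π m, m)`. The set `L'` is the union of the hooks of the dots in `NW(π)`,
while `dom(π)` consists of the boxes with no dot weakly north-west of them.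

Closedness, irreducibility and invariance of `Y_π` hold for every `π`. The vanishing ideal is the
kernel of substituting the entries of a generic product `X π Z`, hence prime
(`vanishingIdeal_borelOrbit`). Entries outside `NW(π)` of a matrix in the orbit can be changed
freely without leaving its closure, and those in `dom(π)` vanish, so extension by zero embeds `Y_π`
in the matrix Schubert variety, whence closedness (`zariskiClosure_varietyY`). Only the dense orbit
depends on `π`.

If `L'` consists of separated hooks, the torus realizes arbitrary nonzero scalings on `L'`
(`exists_torus_of_hooks`). On the Borel orbit the entries on `L'` determine those on `D(π)` by Schur
complements (`eq_of_eq_on_regionL'`), so every projected matrix of the Borel orbit without zero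
coordinates lies in one torus orbit; such points are dense by irreducibility.

Conversely, a dense orbit makes the cross-ratio of any rectangle with corners in `L` constant, in
the form of a binomial equation on `Y_π` with nonzero coefficients (`no_dense_orbit_of_rectangle`).
If two dots of `NW(π)` violate the hook condition, some rectangle and some matrix of the Borel orbit
contradict this (`hooks_of_dense_orbit`). -/

theorem mem_diagram_iff {n : ℕ} {π : Equiv.Perm (Fin n)} {b : Box n} :
    b ∈ diagram π ↔ b.2 < π.symm b.1 ∧ b.1 < π b.2 := by
  constructor
  · rintro ⟨i, j, hij, hπ, rfl⟩
    simpa using ⟨hij, hπ⟩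
  · rintro ⟨h1, h2⟩
    exact ⟨b.2, π.symm b.1, h1, by simpa using h2, by simp⟩

theorem dominantPiece_subset_diagram {n : ℕ} (π : Equiv.Perm (Fin n)) :
    dominantPiece π ⊆ diagram π := fun _ ⟨_, _, hb, _⟩ => hb

theorem diagram_subset_northWest {n : ℕ} (π : Equiv.Perm (Fin n)) :
    diagram π ⊆ northWest π := fun b hb => ⟨b, hb, le_rfl, le_rfl⟩

theorem northWest_mono {n : ℕ} {π : Equiv.Perm (Fin n)} {b c : Box n} (hc : c ∈ northWest π)
    (h1 : b.1 ≤ c.1) (h2 : b.2 ≤ c.2) : b ∈ northWest π := by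
  obtain ⟨d, hd, hd1, hd2⟩ := hc
  exact ⟨d, hd, h1.trans hd1, h2.trans hd2⟩

theorem mem_regionL'_iff {n : ℕ} {π : Equiv.Perm (Fin n)} {b : Box n} :
    b ∈ regionL' π ↔ b ∈ northWest π ∧ b ∉ diagram π :=
  ⟨fun h => ⟨h.1.1, h.2⟩, fun h => ⟨⟨h.1, fun hd => h.2 (dominantPiece_subset_diagram π hd)⟩, h.2⟩⟩

/-- No dot of the permutation matrix of `π` lies weakly north-west of the box `b`. -/
def NoDot {n : ℕ} (π : Equiv.Perm (Fin n)) (b : Box n) : Prop :=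
  ∀ m, m ≤ b.2 → b.1 < π m

theorem NoDot.mem_diagram {n : ℕ} {π : Equiv.Perm (Fin n)} {b : Box n} (h : NoDot π b) :
    b ∈ diagram π := by
  rw [mem_diagram_iff]
  refine ⟨?_, h _ le_rfl⟩
  by_contra hlt
  simpa using h _ (not_lt.mp hlt)

theorem NoDot.mono {n : ℕ} {π : Equiv.Perm (Fin n)} {b c : Box n} (h : NoDot π c)
    (h1 : b.1 ≤ c.1) (h2 : b.2 ≤ c.2) : NoDot π b :=
  fun m hm => h1.trans_lt (h m (hm.trans h2))

/-- A step right or down adds a single column or row to the north-west rectangle. Its dot cannot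
enter the rectangle, because the new box lies in the diagram. -/
theorem NoDot.of_adj {n : ℕ} {π : Equiv.Perm (Fin n)} {b c : Box n} (h : NoDot π c)
    (hb : b ∈ diagram π) (hadj : (grid n).Adj c b) : NoDot π b := by
  intro m hm
  rw [mem_diagram_iff] at hb
  rw [grid, SimpleGraph.boxProd_adj, SimpleGraph.pathGraph_adj, SimpleGraph.pathGraph_adj] at hadj
  by_cases hmc : m ≤ c.2
  · have h1 := h m hmc
    have h2 : b.1 ≠ π m := by
      intro heq
      rw [heq, Equiv.symm_apply_apply] at hb
      exact absurd hb.1 (not_lt.mpr hm)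
    rcases hadj with ⟨h3, h4⟩ | ⟨h3, h4⟩ <;>
      simp only [Fin.lt_def, Fin.le_def, ne_eq, Fin.ext_iff] at * <;> omega
  · have : m = b.2 := by
      rcases hadj with ⟨h3, h4⟩ | ⟨h3, h4⟩ <;>
        simp only [Fin.le_def, Fin.ext_iff] at * <;> omega
    exact this ▸ hb.2

theorem dominantPiece_of_adj {n : ℕ} {π : Equiv.Perm (Fin n)} {b c : Box n}
    (hc : c ∈ dominantPiece π) (hb : b ∈ diagram π) (hadj : (grid n).Adj c b) :
    b ∈ dominantPiece π := by
  obtain ⟨a, ha, hc', h1, h2, hr⟩ := hc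
  exact ⟨a, ha, hb, h1, h2, hr.trans (SimpleGraph.Adj.reachable (by simpa using hadj))⟩

/-- All boxes north-west of a dot-free box are dot-free, hence in the diagram: going up, and then
left along the top row, reaches the corner. -/
theorem NoDot.mem_dominantPiece {n : ℕ} {π : Equiv.Perm (Fin n)} (s : ℕ) :
    ∀ b : Box n, b.1.val + b.2.val = s → NoDot π b → b ∈ dominantPiece π := by
  induction s with
  | zero =>
    intro b hs h
    exact ⟨b, h.mem_diagram, h.mem_diagram, by omega, by omega, SimpleGraph.Reachable.refl _⟩
  | succ s ih =>
    intro b hs h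
    rcases Nat.eq_zero_or_pos b.1.val with h0 | h0
    · let c : Box n := (b.1, ⟨b.2.val - 1, by omega⟩)
      have hle : c.2 ≤ b.2 := by simp [c, Fin.le_def]
      refine dominantPiece_of_adj (ih c (by simp [c]; omega) (h.mono le_rfl hle)) h.mem_diagram ?_
      rw [grid, SimpleGraph.boxProd_adj, SimpleGraph.pathGraph_adj, SimpleGraph.pathGraph_adj]
      right
      exact ⟨Or.inl (by simp [c]; omega), rfl⟩
    · let c : Box n := (⟨b.1.val - 1, by omega⟩, b.2)
      have hle : c.1 ≤ b.1 := by simp [c, Fin.le_def]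
      refine dominantPiece_of_adj (ih c (by simp [c]; omega) (h.mono hle le_rfl)) h.mem_diagram ?_
      rw [grid, SimpleGraph.boxProd_adj, SimpleGraph.pathGraph_adj, SimpleGraph.pathGraph_adj]
      left
      exact ⟨Or.inl (by simp [c]; omega), rfl⟩

theorem noDot_of_mem_dominantPiece {n : ℕ} {π : Equiv.Perm (Fin n)} {b : Box n}
    (h : b ∈ dominantPiece π) : NoDot π b := by
  obtain ⟨a, ha, hb, h1, h2, ⟨w⟩⟩ := h
  have hstart : NoDot π a := by
    intro m hm
    have : m = a.2 := by simp only [Fin.le_def, Fin.ext_iff] at *; omega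
    exact this ▸ (mem_diagram_iff.mp ha).2
  have key : ∀ (u v : diagram π), ((grid n).induce (diagram π)).Walk u v →
      NoDot π u.1 → NoDot π v.1 := by
    intro u v w
    induction w with
    | nil => exact id
    | @cons u v w hadj _ ih => exact fun hu => ih (hu.of_adj v.2 (by simpa using hadj))
  exact key _ _ w hstart

theorem mem_dominantPiece_iff {n : ℕ} {π : Equiv.Perm (Fin n)} {b : Box n} :
    b ∈ dominantPiece π ↔ NoDot π b :=
  ⟨noDot_of_mem_dominantPiece, NoDot.mem_dominantPiece _ b rfl⟩

/-- The boxes of `NW(π)` weakly to the right of or weakly below the dot in column `m`. -/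
def dotHook {n : ℕ} (π : Equiv.Perm (Fin n)) (m : Fin n) : Set (Box n) :=
  {b | b ∈ northWest π ∧ ((b.1 = π m ∧ m ≤ b.2) ∨ (b.2 = m ∧ π m ≤ b.1))}

theorem dotHook_subset_regionL' {n : ℕ} (π : Equiv.Perm (Fin n)) (m : Fin n) :
    dotHook π m ⊆ regionL' π := by
  rintro b ⟨hb, h⟩
  refine mem_regionL'_iff.mpr ⟨hb, fun hd => ?_⟩
  rw [mem_diagram_iff] at hd
  rcases h with ⟨h1, h2⟩ | ⟨h1, h2⟩
  · rw [h1, Equiv.symm_apply_apply] at hd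
    exact absurd hd.1 (not_lt.mpr h2)
  · rw [h1] at hd
    exact absurd hd.2 (not_lt.mpr h2)

theorem exists_dotHook_of_mem_regionL' {n : ℕ} {π : Equiv.Perm (Fin n)} {b : Box n}
    (hb : b ∈ regionL' π) : ∃ m, (π m, m) ∈ northWest π ∧ b ∈ dotHook π m := by
  rw [mem_regionL'_iff, mem_diagram_iff, not_and_or, not_lt, not_lt] at hb
  obtain ⟨hnw, h | h⟩ := hb
  · refine ⟨π.symm b.1, northWest_mono hnw (by simp) h, hnw, Or.inl ⟨by simp, h⟩⟩
  · exact ⟨b.2, northWest_mono hnw h le_rfl, hnw, Or.inr ⟨rfl, h⟩⟩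

theorem isHook_dotHook {n : ℕ} {π : Equiv.Perm (Fin n)} {m : Fin n}
    (hm : (π m, m) ∈ northWest π) : IsHook (dotHook π m) := by
  classical
  obtain ⟨i', hi', hmi⟩ := (Set.toFinite {i | (i, m) ∈ northWest π}).exists_le_maximal hm
  obtain ⟨j', hj', hmj⟩ := (Set.toFinite {j | (π m, j) ∈ northWest π}).exists_le_maximal hm
  refine ⟨π m, i', m, j', hi', hj', ?_⟩
  ext ⟨i, j⟩
  constructor
  · rintro ⟨hnw, ⟨h1, h2⟩ | ⟨h1, h2⟩⟩
    · dsimp only at h1 h2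
      subst h1
      exact Or.inl ⟨rfl, h2, not_lt.mp fun h => absurd (hmj.le_of_ge hnw h.le) (not_le.mpr h)⟩
    · dsimp only at h1 h2
      subst h1
      exact Or.inr ⟨rfl, h2, not_lt.mp fun h => absurd (hmi.le_of_ge hnw h.le) (not_le.mpr h)⟩
  · rintro (⟨h1, h2, h3⟩ | ⟨h1, h2, h3⟩) <;> dsimp only at h1 h2 h3 <;> subst h1
    · exact ⟨northWest_mono hmj.prop le_rfl h3, Or.inl ⟨rfl, h2⟩⟩
    · exact ⟨northWest_mono hmi.prop h3 le_rfl, Or.inr ⟨rfl, h2⟩⟩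

theorem isUnionOfSeparatedHooks_of_dots {n : ℕ} {π : Equiv.Perm (Fin n)}
    (h : ∀ m m', m < m' → (π m, m) ∈ northWest π → (π m', m') ∈ northWest π →
      π m' < π m ∧ (π m, m') ∉ northWest π) :
    IsUnionOfSeparatedHooks (regionL' π) := by
  have hlt : ∀ m m', m < m' → (π m, m) ∈ northWest π → (π m', m') ∈ northWest π →
      NoCommonLine (dotHook π m) (dotHook π m') := by
    rintro m m' hmm hm hm' ⟨i, j⟩ ⟨hb, hb'⟩ ⟨k, l⟩ ⟨hc, hc'⟩
    obtain ⟨h1, h2⟩ := h m m' hmm hm hm'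
    dsimp only at hb' hc' ⊢
    constructor
    · rintro rfl
      have hi : π m ≤ i := by rcases hb' with h | h; exacts [h.1.ge, h.2]
      rcases hc' with h | h
      · exact absurd h1 (not_lt.mpr (h.1 ▸ hi))
      -- A common row must meet the leg of the lower-numbered dot's rival, which then reaches down
      -- to the crossing box `(π m, m')`.
      · obtain ⟨rfl, -⟩ := h
        exact h2 (northWest_mono hc hi le_rfl)
    · rintro rfl
      have hj : m' ≤ j := by rcases hc' with h | h; exacts [h.2, h.1.ge]
      rcases hb' with h | h
      · obtain ⟨rfl, -⟩ := h
        exact h2 (northWest_mono hb le_rfl hj)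
      · exact absurd hmm (not_lt.mpr (h.1 ▸ hj))
  have hsymm : ∀ {H K : Set (Box n)}, NoCommonLine H K → NoCommonLine K H :=
    fun hHK b hb c hc => ⟨(hHK c hc b hb).1.symm, (hHK c hc b hb).2.symm⟩
  have hpair : (dotHook π '' {m | (π m, m) ∈ northWest π}).Pairwise NoCommonLine := by
    rintro _ ⟨m, hm, rfl⟩ _ ⟨m', hm', rfl⟩ hne
    rcases lt_trichotomy m m' with hl | rfl | hl
    · exact hlt m m' hl hm hm'
    · exact absurd rfl hne
    · exact hsymm (hlt m' m hl hm' hm)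
  refine ⟨dotHook π '' {m | (π m, m) ∈ northWest π}, ?_, ?_, hpair, ?_⟩
  · rintro _ ⟨m, hm, rfl⟩
    exact isHook_dotHook hm
  · exact fun H hH K hK hne => Set.disjoint_left.mpr fun b hb hb' =>
      (hpair hH hK hne b hb b hb').1 rfl
  · ext b
    simp only [Set.sUnion_image, Set.mem_iUnion]
    constructor
    · intro hb
      obtain ⟨m, hm, hbm⟩ := exists_dotHook_of_mem_regionL' hb
      exact ⟨m, hm, hbm⟩
    · rintro ⟨m, -, hbm⟩
      exact dotHook_subset_regionL' π m hbm

/-! ### Points of the Borel orbit and their vanishing ideal -/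

theorem mul_permutationMatrix_mul_apply {n : ℕ} (π : Equiv.Perm (Fin n))
    (X Z : Matrix (Fin n) (Fin n) ℂ) (i j : Fin n) :
    (X * permutationMatrix π * Z) i j = ∑ m, X i (π m) * Z m j := by
  simp [Matrix.mul_apply, permutationMatrix]

theorem isUnit_det_of_triangular {ι κ : Type*} [Fintype ι] [DecidableEq ι] [LinearOrder κ]
    (A : Matrix ι ι ℂ) (f : ι → κ) (hf : Function.Injective f)
    (hA : ∀ k l, f k < f l → A k l = 0) (hd : ∀ k, A k k ≠ 0) : IsUnit A.det := by
  let := LinearOrder.lift' f hf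
  have h : A.det = ∏ k, A k k := by
    convert! Matrix.det_of_isLowerTriangular A ?_ using 1
    intro k l hkl
    exact hA k l hkl
  rw [h, isUnit_iff_ne_zero]
  exact Finset.prod_ne_zero_iff.mpr fun k _ => hd k

theorem upper_inv {n : ℕ} (Z : Matrix (Fin n) (Fin n) ℂ) (hZ : ∀ i j, j < i → Z i j = 0)
    (hd : IsUnit Z.det) : ∀ i j, j < i → Z⁻¹ i j = 0 := by
  have := Matrix.invertibleOfIsUnitDet Z hd
  have h : Z.BlockTriangular id := fun i j hij => hZ i j hij
  exact fun i j hij => Matrix.blockTriangular_inv_of_blockTriangular h hij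

theorem lower_inv {n : ℕ} (X : Matrix (Fin n) (Fin n) ℂ) (hX : ∀ i j, i < j → X i j = 0)
    (hd : IsUnit X.det) : ∀ i j, i < j → X⁻¹ i j = 0 := by
  intro i j hij
  have h := upper_inv X.transpose (fun i j hij => hX j i hij) (by rwa [Matrix.det_transpose]) j i hij
  rwa [← Matrix.transpose_nonsing_inv] at h

theorem diag_ne_zero_of_lower {n : ℕ} (X : Matrix (Fin n) (Fin n) ℂ)
    (hX : ∀ i j, i < j → X i j = 0) (hd : IsUnit X.det) (i : Fin n) : X i i ≠ 0 := by
  rw [Matrix.det_of_isLowerTriangular X (fun i j hij => hX i j hij), isUnit_iff_ne_zero,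
    Finset.prod_ne_zero_iff] at hd
  exact hd i (Finset.mem_univ i)

theorem diag_ne_zero_of_upper {n : ℕ} (Z : Matrix (Fin n) (Fin n) ℂ)
    (hZ : ∀ i j, j < i → Z i j = 0) (hd : IsUnit Z.det) (i : Fin n) : Z i i ≠ 0 :=
  diag_ne_zero_of_lower Z.transpose (fun i j hij => hZ j i hij) (by rwa [Matrix.det_transpose]) i

theorem mem_borelOrbit_iff {n : ℕ} {π : Equiv.Perm (Fin n)} {M : Matrix (Fin n) (Fin n) ℂ} :
    M ∈ borelOrbit π ↔ ∃ X Z : Matrix (Fin n) (Fin n) ℂ, (∀ i j, i < j → X i j = 0) ∧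
      (∀ i j, j < i → Z i j = 0) ∧ (∀ i, X i i ≠ 0) ∧ (∀ i, Z i i ≠ 0) ∧
      M = X * permutationMatrix π * Z := by
  constructor
  · rintro ⟨X, Y, hX, hY, rfl⟩
    have hXd : IsUnit X.val.det := (Matrix.isUnit_iff_isUnit_det _).mp X.isUnit
    have hYd : IsUnit Y.val.det := (Matrix.isUnit_iff_isUnit_det _).mp Y.isUnit
    have hYd' : IsUnit (Y⁻¹).val.det := (Matrix.isUnit_iff_isUnit_det _).mp (Y⁻¹).isUnit
    have hY' : ∀ i j, j < i → (Y⁻¹).val i j = 0 := by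
      rw [Matrix.coe_units_inv]
      exact upper_inv Y.val hY hYd
    exact ⟨X.val, (Y⁻¹).val, hX, hY', diag_ne_zero_of_lower _ hX hXd,
      diag_ne_zero_of_upper _ hY' hYd', rfl⟩
  · rintro ⟨X, Z, hX, hZ, hX', hZ', rfl⟩
    have hXd : IsUnit X.det := isUnit_det_of_triangular X id Function.injective_id hX hX'
    have hZd : IsUnit Z.det := by
      rw [← Matrix.det_transpose]
      exact isUnit_det_of_triangular _ id Function.injective_id (fun i j h => hZ j i h) hZ'
    refine ⟨Matrix.nonsingInvUnit X hXd, (Matrix.nonsingInvUnit Z hZd)⁻¹, hX, ?_, ?_⟩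
    · rw [Matrix.coe_units_inv]
      exact upper_inv Z hZ hZd
    · rw [inv_inv]; rfl

open MvPolynomial in
/-- The entry in row `i` and column `j` of the generic matrix `X π Z`, where `X` is lower and `Z` is
upper triangular. -/
noncomputable def genericEntry {n : ℕ} (π : Equiv.Perm (Fin n)) (b : Box n) :
    MvPolynomial (Box n ⊕ Box n) ℂ :=
  ∑ m, (if π m ≤ b.1 then X (Sum.inl (b.1, π m)) else 0) *
    (if m ≤ b.2 then X (Sum.inr (m, b.2)) else 0)

/-- The entries of `M` in the boxes `e s`. -/
def entries {n : ℕ} {σ : Type} (e : σ → Box n) (M : Matrix (Fin n) (Fin n) ℂ) : σ → ℂ :=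
  fun s => M (e s).1 (e s).2

/-- Substitution of the entries of the generic matrix `X π Z`. -/
noncomputable def substGeneric {n : ℕ} (π : Equiv.Perm (Fin n)) {σ : Type} (e : σ → Box n) :
    MvPolynomial σ ℂ →ₐ[ℂ] MvPolynomial (Box n ⊕ Box n) ℂ :=
  MvPolynomial.aeval fun s => genericEntry π (e s)

theorem aeval_substGeneric {n : ℕ} (π : Equiv.Perm (Fin n)) {σ : Type} (e : σ → Box n)
    (f : MvPolynomial σ ℂ) (x : Box n ⊕ Box n → ℂ) :
    MvPolynomial.aeval x (substGeneric π e f) =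
      MvPolynomial.aeval (entries e ((Matrix.of fun i j => if j ≤ i then x (Sum.inl (i, j)) else 0) *
        permutationMatrix π *
        (Matrix.of fun i j => if i ≤ j then x (Sum.inr (i, j)) else 0))) f := by
  rw [substGeneric, ← AlgHom.comp_apply]
  congr 1
  ext s
  simp only [AlgHom.comp_apply, MvPolynomial.aeval_X, genericEntry, map_sum, map_mul, entries,
    mul_permutationMatrix_mul_apply, Matrix.of_apply]
  refine Finset.sum_congr rfl fun m _ => ?_
  congr 1 <;> split_ifs <;> simp

theorem substGeneric_eq_zero {n : ℕ} {π : Equiv.Perm (Fin n)} {σ : Type} {e : σ → Box n}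
    {f : MvPolynomial σ ℂ}
    (hf : f ∈ MvPolynomial.vanishingIdeal ℂ (entries e '' borelOrbit π)) :
    substGeneric π e f = 0 := by
  -- The diagonal variables kill the locus where a triangular factor is singular; elsewhere the
  -- product `X π Z` lies in the Borel orbit.
  have h : substGeneric π e f * ((∏ i, MvPolynomial.X (Sum.inl (i, i))) *
      ∏ i, MvPolynomial.X (Sum.inr (i, i))) = 0 := by
    refine MvPolynomial.funext fun x => ?_
    rw [map_zero, map_mul, map_mul, map_prod, map_prod]
    simp only [MvPolynomial.eval_X]
    by_cases hx : (∀ i, x (Sum.inl (i, i)) ≠ 0) ∧ ∀ i, x (Sum.inr (i, i)) ≠ 0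
    · rw [← MvPolynomial.coe_aeval_eq_eval, RingHom.coe_coe, aeval_substGeneric]
      rw [hf _ ⟨_, mem_borelOrbit_iff.mpr ⟨_, _, ?_, ?_, ?_, ?_, rfl⟩, rfl⟩, zero_mul]
      · intro i j hij; simp [not_le.mpr hij]
      · intro i j hij; simp [not_le.mpr hij]
      · intro i; simpa using hx.1 i
      · intro i; simpa using hx.2 i
    · rw [not_and_or] at hx
      push Not at hx
      rcases hx with ⟨i, hi⟩ | ⟨i, hi⟩
      · rw [Finset.prod_eq_zero (Finset.mem_univ i) hi]; simp
      · rw [Finset.prod_eq_zero (f := fun i => x (Sum.inr (i, i))) (Finset.mem_univ i) hi]; simp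
  refine (mul_eq_zero.mp h).resolve_right (mul_ne_zero ?_ ?_) <;>
    exact Finset.prod_ne_zero_iff.mpr fun i _ => MvPolynomial.X_ne_zero _

/-- The triangular factors may be singular here, which allows arbitrary polynomial curves of factors
later. -/
theorem aeval_eq_zero_of_triangular {n : ℕ} {π : Equiv.Perm (Fin n)} {σ : Type} {e : σ → Box n}
    {f : MvPolynomial σ ℂ} (hf : substGeneric π e f = 0)
    {X Z : Matrix (Fin n) (Fin n) ℂ} (hX : ∀ i j, i < j → X i j = 0)
    (hZ : ∀ i j, j < i → Z i j = 0) :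
    MvPolynomial.aeval (entries e (X * permutationMatrix π * Z)) f = 0 := by
  have h := aeval_substGeneric π e f (Sum.elim (fun b => X b.1 b.2) fun b => Z b.1 b.2)
  rw [hf, map_zero] at h
  rw [h]
  congr 4
  · congr 1
    ext i j
    by_cases hij : j ≤ i
    · simp [hij]
    · simp [hij, hX i j (not_le.mp hij)]
  · ext i j
    by_cases hij : i ≤ j
    · simp [hij]
    · simp [hij, hZ i j (not_le.mp hij)]

theorem vanishingIdeal_borelOrbit {n : ℕ} (π : Equiv.Perm (Fin n)) {σ : Type} (e : σ → Box n) :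
    MvPolynomial.vanishingIdeal ℂ (entries e '' borelOrbit π) = RingHom.ker (substGeneric π e) := by
  ext f
  refine ⟨fun hf => substGeneric_eq_zero hf, ?_⟩
  rintro hf _ ⟨M, hM, rfl⟩
  obtain ⟨X, Z, hX, hZ, -, -, rfl⟩ := mem_borelOrbit_iff.mp hM
  exact aeval_eq_zero_of_triangular hf hX hZ

theorem subset_zariskiClosure {σ : Type} (S : Set (σ → ℂ)) : S ⊆ zariskiClosure S :=
  MvPolynomial.zeroLocus_vanishingIdeal_le S

theorem entries_mem_varietyY {n : ℕ} {π : Equiv.Perm (Fin n)} {M : Matrix (Fin n) (Fin n) ℂ}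
    (hM : M ∈ borelOrbit π) : entries Subtype.val M ∈ varietyY π :=
  ⟨entries id M, subset_zariskiClosure _ ⟨M, hM, rfl⟩, rfl⟩

theorem vanishingIdeal_varietyY {n : ℕ} (π : Equiv.Perm (Fin n)) :
    MvPolynomial.vanishingIdeal ℂ (varietyY π) =
      MvPolynomial.vanishingIdeal ℂ
        (entries (Subtype.val : regionL π → Box n) '' borelOrbit π) := by
  refine le_antisymm (MvPolynomial.vanishingIdeal_anti_mono ?_) ?_
  · rintro _ ⟨M, hM, rfl⟩
    exact entries_mem_varietyY hM
  · rintro f hf _ ⟨x, hx, rfl⟩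
    have h : MvPolynomial.rename Subtype.val f ∈
        MvPolynomial.vanishingIdeal ℂ (entries id '' borelOrbit π) := by
      rintro _ ⟨M, hM, rfl⟩
      rw [MvPolynomial.aeval_rename]
      exact hf _ ⟨M, hM, rfl⟩
    have h' := hx _ h
    rwa [MvPolynomial.aeval_rename] at h'

theorem isPrime_vanishingIdeal_varietyY {n : ℕ} (π : Equiv.Perm (Fin n)) :
    (MvPolynomial.vanishingIdeal ℂ (varietyY π)).IsPrime := by
  rw [vanishingIdeal_varietyY, vanishingIdeal_borelOrbit]
  exact RingHom.ker_isPrime _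

/-! ### The torus action on the Borel orbit -/

/-- The matrix `A M B⁻¹` for invertible diagonal matrices `A` and `B`. -/
def torusMul {n : ℕ} (t : Torus n) (M : Matrix (Fin n) (Fin n) ℂ) : Matrix (Fin n) (Fin n) ℂ :=
  Matrix.of fun i j => (t.1 i * (t.2 j)⁻¹ : ℂˣ) * M i j

theorem torusMul_mem_borelOrbit {n : ℕ} {π : Equiv.Perm (Fin n)} {M : Matrix (Fin n) (Fin n) ℂ}
    (hM : M ∈ borelOrbit π) (t : Torus n) : torusMul t M ∈ borelOrbit π := by
  obtain ⟨X, Z, hX, hZ, hX', hZ', rfl⟩ := mem_borelOrbit_iff.mp hM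
  refine mem_borelOrbit_iff.mpr ⟨Matrix.of fun i j => t.1 i * X i j,
    Matrix.of fun i j => ((t.2 j)⁻¹ : ℂˣ) * Z i j, ?_, ?_, ?_, ?_, ?_⟩
  · intro i j hij; simp [hX i j hij]
  · intro i j hij; simp [hZ i j hij]
  · intro i; simpa using hX' i
  · intro i; simpa using hZ' i
  · ext i j
    simp only [torusMul, Matrix.of_apply, mul_permutationMatrix_mul_apply, Finset.mul_sum]
    refine Finset.sum_congr rfl fun m _ => ?_
    push_cast
    ring

theorem quotientTorusAction_mk_apply {n : ℕ} (S : Set (Box n)) (t : Torus n) (x : S → ℂ) (b : S) :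
    quotientTorusAction S (t : QuotientTorus n) x b = (t.1 b.1.1 * (t.2 b.1.2)⁻¹ : ℂˣ) * x b := rfl

theorem varietyY_invariant {n : ℕ} (π : Equiv.Perm (Fin n)) (t : QuotientTorus n)
    (y : regionL π → ℂ) (hy : y ∈ varietyY π) :
    quotientTorusAction (regionL π) t y ∈ varietyY π := by
  induction t using QuotientGroup.induction_on with | H t => ?_
  obtain ⟨x, hx, rfl⟩ := hy
  refine ⟨fun b => (t.1 b.1 * (t.2 b.2)⁻¹ : ℂˣ) * x b, ?_, ?_⟩
  · intro f hf
    let g : MvPolynomial (Box n) ℂ := MvPolynomial.aeval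
      (fun b => MvPolynomial.C ((t.1 b.1 * (t.2 b.2)⁻¹ : ℂˣ) : ℂ) * MvPolynomial.X b) f
    have hg : ∀ z : Box n → ℂ, MvPolynomial.aeval z g =
        MvPolynomial.aeval (fun b => ((t.1 b.1 * (t.2 b.2)⁻¹ : ℂˣ) : ℂ) * z b) f := by
      intro z
      rw [← AlgHom.comp_apply, MvPolynomial.comp_aeval]
      simp
    rw [← hg]
    refine hx g ?_
    rintro _ ⟨M, hM, rfl⟩
    rw [hg]
    exact hf _ ⟨torusMul t M, torusMul_mem_borelOrbit hM t, rfl⟩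
  · rfl

/-! ### Directional derivatives and closedness of `Y_π` -/

/-- The derivative in the constant direction `v`. -/
noncomputable def directionalDerivative {σ : Type} (v : σ → ℂ) :
    Derivation ℂ (MvPolynomial σ ℂ) (MvPolynomial σ ℂ) :=
  MvPolynomial.mkDerivation ℂ fun s => MvPolynomial.C (v s)

open Polynomial in
theorem derivative_aeval_line {σ : Type} (u v : σ → ℂ) (f : MvPolynomial σ ℂ) :
    derivative (MvPolynomial.aeval (fun s => C (u s) + X * C (v s)) f) =
      MvPolynomial.aeval (fun s => C (u s) + X * C (v s)) (directionalDerivative v f) := by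
  induction f using MvPolynomial.induction_on with
  | C a => simp [directionalDerivative]
  | add p q hp hq => simp only [map_add, hp, hq]
  | mul_X p s hp =>
    rw [map_mul, derivative_mul, hp, MvPolynomial.aeval_X, Derivation.leibniz]
    simp [directionalDerivative, MvPolynomial.mkDerivation_X]
    ring

open Polynomial in
theorem eval_aeval {σ : Type} (z : ℂ) (γ : σ → ℂ[X]) (f : MvPolynomial σ ℂ) :
    (MvPolynomial.aeval γ f).eval z = MvPolynomial.aeval (fun s => (γ s).eval z) f := by
  induction f using MvPolynomial.induction_on with
  | C a => simp
  | add p q hp hq => simp only [map_add, eval_add, hp, hq]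
  | mul_X p s hp => simp [hp]

open Polynomial in
theorem eval_zero_derivative_aeval {σ : Type} (γ : σ → ℂ[X]) (f : MvPolynomial σ ℂ) :
    (derivative (MvPolynomial.aeval γ f)).eval 0 =
      MvPolynomial.aeval (fun s => (γ s).eval 0)
        (directionalDerivative (fun s => (derivative (γ s)).eval 0) f) := by
  induction f using MvPolynomial.induction_on with
  | C a => simp [directionalDerivative]
  | add p q hp hq => simp only [map_add, eval_add, hp, hq]
  | mul_X p s hp =>
    rw [map_mul, derivative_mul, eval_add, eval_mul, eval_mul, hp, MvPolynomial.aeval_X,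
      Derivation.leibniz, eval_aeval]
    simp [directionalDerivative, MvPolynomial.mkDerivation_X]
    ring

-- Restrict `f` to the line `u + t v`. All derivatives in `t` vanish at `0` because the ideal is
-- stable under the derivation, so in characteristic zero the restriction is zero; then take `t =
-- 1`.
open Polynomial in
theorem aeval_add_eq_zero {σ : Type} (S : Set (σ → ℂ)) (v : σ → ℂ)
    (hS : ∀ f ∈ MvPolynomial.vanishingIdeal ℂ S,
      directionalDerivative v f ∈ MvPolynomial.vanishingIdeal ℂ S)
    {u : σ → ℂ} (hu : u ∈ S) {f : MvPolynomial σ ℂ} (hf : f ∈ MvPolynomial.vanishingIdeal ℂ S) :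
    MvPolynomial.aeval (u + v) f = 0 := by
  let γ : σ → ℂ[X] := fun s => C (u s) + X * C (v s)
  have hev : ∀ (z : ℂ) (g : MvPolynomial σ ℂ), (MvPolynomial.aeval γ g).eval z =
      MvPolynomial.aeval (fun s => u s + z * v s) g := by
    intro z g
    rw [eval_aeval]
    simp only [γ, eval_add, eval_C, eval_mul, eval_X]
  have hiter : ∀ k : ℕ, ∃ g ∈ MvPolynomial.vanishingIdeal ℂ S,
      derivative^[k] (MvPolynomial.aeval γ f) = MvPolynomial.aeval γ g := by
    intro k
    induction k with
    | zero => exact ⟨f, hf, rfl⟩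
    | succ k ih =>
      obtain ⟨g, hg, h⟩ := ih
      exact ⟨_, hS g hg, by rw [Function.iterate_succ_apply', h, derivative_aeval_line]⟩
  have hzero : MvPolynomial.aeval γ f = 0 := by
    ext k
    obtain ⟨g, hg, h⟩ := hiter k
    have h0 : (derivative^[k] (MvPolynomial.aeval γ f)).coeff 0 = 0 := by
      rw [h, coeff_zero_eq_eval_zero, hev]
      simpa using hg u hu
    rw [coeff_iterate_derivative, zero_add, Nat.descFactorial_self, nsmul_eq_mul] at h0
    simpa [Nat.factorial_ne_zero] using h0
  have h1 := hev 1 f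
  rw [hzero] at h1
  simpa [Pi.add_def] using h1.symm

/-- An entry strictly below the dot of its column is assigned to `A`, every other entry to `B`. An
entry of `B` below the diagonal then comes from a diagram box, where `N` vanishes. -/
theorem exists_triangular_decomposition {n : ℕ} {π : Equiv.Perm (Fin n)}
    (N : Matrix (Fin n) (Fin n) ℂ) (hN : ∀ b ∈ diagram π, N b.1 b.2 = 0) :
    ∃ A B : Matrix (Fin n) (Fin n) ℂ, (∀ i j, i < j → A i j = 0) ∧ (∀ i j, j < i → B i j = 0) ∧
      A * permutationMatrix π + permutationMatrix π * B = N := by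
  refine ⟨Matrix.of fun i k => if k < i then N i (π.symm k) else 0,
    Matrix.of fun m j => if π j < π m then 0 else N (π m) j, ?_, ?_, ?_⟩
  · intro i j hij
    simp [hij.not_gt]
  · intro i j hij
    simp only [Matrix.of_apply]
    split_ifs with h
    · rfl
    · refine hN (π i, j) (mem_diagram_iff.mpr ⟨by simpa using hij, ?_⟩)
      exact lt_of_le_of_ne (not_lt.mp h) (π.injective.ne hij.ne')
  · ext i j
    rw [Matrix.add_apply, Matrix.mul_apply, Matrix.mul_apply,
      Finset.sum_eq_single (π j) (by simp +contextual [permutationMatrix, eq_comm]) (by simp),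
      Finset.sum_eq_single (π.symm i)
        (fun k _ hk => by simp [permutationMatrix, ← Equiv.eq_symm_apply, hk]) (by simp)]
    by_cases h : π j < i <;> simp [permutationMatrix, h]

/-- Translation by `Y` and `Z` reduces to the tangent space at `π`: vanishing on `NW(π)` is
preserved by `N ↦ Y⁻¹ N Z⁻¹`. -/
theorem exists_tangent_decomposition {n : ℕ} {π : Equiv.Perm (Fin n)}
    {N Y Z : Matrix (Fin n) (Fin n) ℂ} (hN : ∀ b ∈ northWest π, N b.1 b.2 = 0)
    (hY : ∀ i j, i < j → Y i j = 0) (hZ : ∀ i j, j < i → Z i j = 0) (hY' : ∀ i, Y i i ≠ 0)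
    (hZ' : ∀ i, Z i i ≠ 0) :
    ∃ A B : Matrix (Fin n) (Fin n) ℂ, (∀ i j, i < j → A i j = 0) ∧ (∀ i j, j < i → B i j = 0) ∧
      A * permutationMatrix π * Z + Y * permutationMatrix π * B = N := by
  have hYd : IsUnit Y.det := isUnit_det_of_triangular Y id Function.injective_id hY hY'
  have hZd : IsUnit Z.det := by
    rw [← Matrix.det_transpose]
    exact isUnit_det_of_triangular _ id Function.injective_id (fun i j h => hZ j i h) hZ'
  obtain ⟨A, B, hA, hB, hsum⟩ := exists_triangular_decomposition (π := π) (Y⁻¹ * N * Z⁻¹) (by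
    intro b hb
    replace hb := diagram_subset_northWest π hb
    simp only [Matrix.mul_apply]
    refine Finset.sum_eq_zero fun j _ => ?_
    rcases le_or_gt j b.2 with hj | hj
    · rw [Finset.sum_eq_zero, zero_mul]
      intro i _
      rcases le_or_gt i b.1 with hi | hi
      · rw [hN (i, j) (northWest_mono hb hi hj), mul_zero]
      · rw [lower_inv Y hY hYd _ _ hi, zero_mul]
    · rw [upper_inv Z hZ hZd _ _ hj, mul_zero])
  refine ⟨Y * A, B * Z, ?_, ?_, ?_⟩
  · intro i j hij
    rw [Matrix.mul_apply]
    refine Finset.sum_eq_zero fun k _ => ?_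
    rcases le_or_gt k i with hk | hk
    · rw [hA k j (hk.trans_lt hij), mul_zero]
    · rw [hY i k hk, zero_mul]
  · intro i j hij
    rw [Matrix.mul_apply]
    refine Finset.sum_eq_zero fun k _ => ?_
    rcases le_or_gt i k with hk | hk
    · rw [hZ k j (hij.trans_le hk), mul_zero]
    · rw [hB i k hk, zero_mul]
  · calc _ = Y * (A * permutationMatrix π + permutationMatrix π * B) * Z := by
          simp only [Matrix.mul_add, Matrix.add_mul, Matrix.mul_assoc]
      _ = (Y * Y⁻¹) * N * (Z⁻¹ * Z) := by
          rw [hsum]; simp only [Matrix.mul_assoc]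
      _ = N := by rw [Matrix.mul_nonsing_inv _ hYd, Matrix.nonsing_inv_mul _ hZd]; simp

-- The curve `(Y + t A) π (Z + t B)` has velocity `N` at `t = 0`, and `f` vanishes along it.
open Polynomial in
theorem directionalDerivative_mem {n : ℕ} {π : Equiv.Perm (Fin n)}
    (N : Matrix (Fin n) (Fin n) ℂ) (hN : ∀ b ∈ northWest π, N b.1 b.2 = 0)
    {f : MvPolynomial (Box n) ℂ}
    (hf : f ∈ MvPolynomial.vanishingIdeal ℂ (entries id '' borelOrbit π)) :
    directionalDerivative (entries id N) f ∈
      MvPolynomial.vanishingIdeal ℂ (entries id '' borelOrbit π) := by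
  rintro _ ⟨M, hM, rfl⟩
  obtain ⟨Y, Z, hY, hZ, hY', hZ', rfl⟩ := mem_borelOrbit_iff.mp hM
  obtain ⟨A, B, hA, hB, hsum⟩ := exists_tangent_decomposition hN hY hZ hY' hZ'
  let γ : Box n → ℂ[X] := fun b => C ((Y * permutationMatrix π * Z) b.1 b.2) +
    X * C (N b.1 b.2) + X ^ 2 * C ((A * permutationMatrix π * B) b.1 b.2)
  have hcurve : ∀ z : ℂ, (Y + z • A) * permutationMatrix π * (Z + z • B) =
      Y * permutationMatrix π * Z + z • N + z ^ 2 • (A * permutationMatrix π * B) := by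
    intro z
    rw [← hsum]
    simp only [Matrix.add_mul, Matrix.mul_add, Matrix.smul_mul, Matrix.mul_smul, smul_smul,
      smul_add, pow_two]
    abel
  have hzero : MvPolynomial.aeval γ f = 0 := by
    refine Polynomial.funext fun z => ?_
    have h := aeval_eq_zero_of_triangular (X := Y + z • A) (Z := Z + z • B)
      (substGeneric_eq_zero hf)
      (fun i j hij => by simp [hY i j hij, hA i j hij])
      (fun i j hij => by simp [hZ i j hij, hB i j hij])
    rw [hcurve] at h
    rw [eval_aeval, eval_zero, ← h]
    congr 2
    ext b
    simp only [γ, entries, eval_add, eval_C, eval_mul, eval_X, eval_pow, Matrix.add_apply,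
      Matrix.smul_apply, smul_eq_mul, id]
  have h := eval_zero_derivative_aeval γ f
  rw [hzero] at h
  simp only [derivative_zero, eval_zero] at h
  rw [h]
  have h1 : (fun b => (γ b).eval 0) = entries id (Y * permutationMatrix π * Z) := by
    ext b
    simp [γ, entries]
  have h2 : (fun b => (derivative (γ b)).eval 0) = entries id N := by
    ext b
    simp [γ, entries]
  rw [h1, h2]

theorem apply_eq_zero_of_mem_dominantPiece {n : ℕ} {π : Equiv.Perm (Fin n)}
    {M : Matrix (Fin n) (Fin n) ℂ} (hM : M ∈ borelOrbit π) {b : Box n}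
    (hb : b ∈ dominantPiece π) : M b.1 b.2 = 0 := by
  obtain ⟨X, Z, hX, hZ, -, -, rfl⟩ := mem_borelOrbit_iff.mp hM
  rw [mul_permutationMatrix_mul_apply]
  refine Finset.sum_eq_zero fun m _ => ?_
  rcases le_or_gt m b.2 with hm | hm
  · rw [hX _ _ (mem_dominantPiece_iff.mp hb m hm), zero_mul]
  · rw [hZ _ _ hm, mul_zero]

theorem zariskiClosure_varietyY {n : ℕ} (π : Equiv.Perm (Fin n)) :
    zariskiClosure (varietyY π) = varietyY π := by
  classical
  refine subset_antisymm (fun y hy => ?_) (subset_zariskiClosure _)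
  refine ⟨fun b => if h : b ∈ regionL π then y ⟨b, h⟩ else 0, ?_, by ext b; simp⟩
  intro f hf
  let g : MvPolynomial (regionL π) ℂ := MvPolynomial.aeval
    (fun b => if h : b ∈ regionL π then MvPolynomial.X ⟨b, h⟩ else 0) f
  have hg : ∀ z : regionL π → ℂ, MvPolynomial.aeval z g =
      MvPolynomial.aeval (fun b => if h : b ∈ regionL π then z ⟨b, h⟩ else 0) f := by
    intro z
    rw [← AlgHom.comp_apply, MvPolynomial.comp_aeval]
    congr 2
    ext b
    split_ifs <;> simp
  rw [← hg]
  refine hy g ?_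
  rw [vanishingIdeal_varietyY]
  rintro _ ⟨M, hM, rfl⟩
  rw [hg]
  -- Adding `N` to `M` erases all entries outside `L`. It is an admissible direction because `M`
  -- already vanishes on `dom(π)`.
  let N : Matrix (Fin n) (Fin n) ℂ := Matrix.of fun i j => if (i, j) ∈ regionL π then 0 else - M i j
  have hN : ∀ b ∈ northWest π, N b.1 b.2 = 0 := by
    intro b hb
    simp only [N, Matrix.of_apply]
    split_ifs with h
    · rfl
    · have hdom : b ∈ dominantPiece π := by
        by_contra hd
        exact h ⟨hb, hd⟩
      rw [apply_eq_zero_of_mem_dominantPiece hM hdom, neg_zero]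
  have h := aeval_add_eq_zero (entries id '' borelOrbit π) (entries id N)
    (fun f hf => directionalDerivative_mem N hN hf) ⟨M, hM, rfl⟩ hf
  have hsum : (fun b => if h : b ∈ regionL π then entries Subtype.val M ⟨b, h⟩ else 0) =
      entries id M + entries id N := by
    ext b
    by_cases hb : b ∈ regionL π <;> simp [entries, N, hb]
  rw [hsum, h]

/-! ### Entries in the diagram are determined by the entries outside of it -/

/-- Only dots weakly north-west of `d` contribute to entries weakly north-west of `d`. Hence the
block on the rows and columns of these dots factors as an invertible `Xs * Zs`, which cancels. -/
theorem apply_eq_schurComplement {n : ℕ} {π : Equiv.Perm (Fin n)} {X Z : Matrix (Fin n) (Fin n) ℂ}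
    (hX : ∀ i j, i < j → X i j = 0) (hZ : ∀ i j, j < i → Z i j = 0) (hX' : ∀ i, X i i ≠ 0)
    (hZ' : ∀ i, Z i i ≠ 0) (d : Box n) :
    let M := X * permutationMatrix π * Z
    let ι := {k : Fin n // k ≤ d.2 ∧ π k ≤ d.1}
    M d.1 d.2 = (fun k : ι => M d.1 k.1) ⬝ᵥ
      Matrix.mulVec (Matrix.of fun k l : ι => M (π k.1) l.1)⁻¹ (fun k : ι => M (π k.1) d.2) := by
  intro M ι
  let Xs : Matrix ι ι ℂ := Matrix.of fun k l => X (π k.1) (π l.1)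
  let Zs : Matrix ι ι ℂ := Matrix.of fun k l => Z k.1 l.1
  have hM : ∀ i j, i ≤ d.1 → j ≤ d.2 → M i j = ∑ m : ι, X i (π m.1) * Z m.1 j := by
    intro i j hi hj
    simp only [M, mul_permutationMatrix_mul_apply]
    rw [← Finset.sum_filter_add_sum_filter_not _ (fun k => k ≤ d.2 ∧ π k ≤ d.1),
      Finset.sum_eq_zero (s := Finset.univ.filter fun k => ¬(k ≤ d.2 ∧ π k ≤ d.1)), add_zero]
    · exact Finset.sum_subtype _ (by simp) fun k => X i (π k) * Z k j
    · intro k hk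
      simp only [Finset.mem_filter, Finset.mem_univ, true_and, not_and_or, not_le] at hk
      rcases hk with hk | hk
      · rw [hZ _ _ (hj.trans_lt hk), mul_zero]
      · rw [hX _ _ (hi.trans_lt hk), zero_mul]
  have hXd : IsUnit Xs.det := isUnit_det_of_triangular Xs (fun k => π k.1)
    (π.injective.comp Subtype.val_injective) (fun k l h => hX _ _ h) fun k => hX' _
  have hZd : IsUnit Zs.det := by
    rw [← Matrix.det_transpose]
    exact isUnit_det_of_triangular _ (fun k : ι => k.1) Subtype.val_injective
      (fun k l h => hZ _ _ h) fun k => hZ' _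
  have h1 : (Matrix.of fun k l : ι => M (π k.1) l.1) = Xs * Zs := by
    ext k l
    rw [Matrix.of_apply, hM _ _ k.2.2 l.2.1]
    simp [Matrix.mul_apply, Xs, Zs]
  have h2 : (fun k : ι => M d.1 k.1) = Matrix.vecMul (fun m : ι => X d.1 (π m.1)) Zs := by
    ext k
    rw [hM _ _ le_rfl k.2.1]
    simp [Matrix.vecMul, dotProduct, Zs]
  have h3 : (fun k : ι => M (π k.1) d.2) = Matrix.mulVec Xs (fun m : ι => Z m.1 d.2) := by
    ext k
    rw [hM _ _ k.2.2 le_rfl]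
    simp [Matrix.mulVec, dotProduct, Xs]
  rw [h1, h2, h3, Matrix.mul_inv_rev, Matrix.mulVec_mulVec, Matrix.mul_assoc,
    Matrix.nonsing_inv_mul _ hXd, Matrix.mul_one, ← Matrix.dotProduct_mulVec, Matrix.mulVec_mulVec,
    Matrix.mul_nonsing_inv _ hZd, Matrix.one_mulVec, hM _ _ le_rfl le_rfl]
  rfl

theorem eq_of_eq_on_regionL' {n : ℕ} {π : Equiv.Perm (Fin n)} {M M' : Matrix (Fin n) (Fin n) ℂ}
    (hM : M ∈ borelOrbit π) (hM' : M' ∈ borelOrbit π)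
    (h : ∀ b ∈ regionL' π, M b.1 b.2 = M' b.1 b.2) (s : ℕ) :
    ∀ b ∈ northWest π, b.1.val + b.2.val = s → M b.1 b.2 = M' b.1 b.2 := by
  induction s using Nat.strong_induction_on with
  | _ s ih =>
    intro b hb hs
    by_cases hd : b ∈ diagram π
    · have hlt : ∀ k, k ≤ b.2 ∧ π k ≤ b.1 → k < b.2 ∧ π k < b.1 := by
        rintro k ⟨h1, h2⟩
        rw [mem_diagram_iff] at hd
        refine ⟨lt_of_le_of_ne h1 ?_, lt_of_le_of_ne h2 ?_⟩
        · rintro rfl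
          exact absurd hd.2 (not_lt.mpr h2)
        · intro heq
          rw [← heq, Equiv.symm_apply_apply] at hd
          exact absurd hd.1 (not_lt.mpr h1)
      have hsmall : ∀ i j, i ≤ b.1 → j ≤ b.2 → (i < b.1 ∨ j < b.2) → M i j = M' i j := by
        intro i j hi hj hij
        refine ih (i.val + j.val) ?_ (i, j) (northWest_mono hb hi hj) rfl
        simp only [Fin.lt_def, Fin.le_def] at *
        omega
      obtain ⟨X, Z, hX, hZ, hX', hZ', hMe⟩ := mem_borelOrbit_iff.mp hM
      obtain ⟨U, V, hU, hV, hU', hV', hMe'⟩ := mem_borelOrbit_iff.mp hM'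
      have e1 := apply_eq_schurComplement (π := π) hX hZ hX' hZ' b
      have e2 := apply_eq_schurComplement (π := π) hU hV hU' hV' b
      rw [← hMe] at e1
      rw [← hMe'] at e2
      dsimp only at e1 e2
      rw [e1, e2]
      have g1 : (fun k : {k : Fin n // k ≤ b.2 ∧ π k ≤ b.1} => M b.1 k.1) =
          fun k => M' b.1 k.1 :=
        funext fun k => hsmall _ _ le_rfl k.2.1 (Or.inr (hlt _ k.2).1)
      have g2 : (fun k : {k : Fin n // k ≤ b.2 ∧ π k ≤ b.1} => M (π k.1) b.2) =
          fun k => M' (π k.1) b.2 :=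
        funext fun k => hsmall _ _ k.2.2 le_rfl (Or.inl (hlt _ k.2).2)
      have g3 : (fun k l : {k : Fin n // k ≤ b.2 ∧ π k ≤ b.1} => M (π k.1) l.1) =
          fun k l => M' (π k.1) l.1 :=
        funext fun k => funext fun l => hsmall _ _ k.2.2 l.2.1 (Or.inl (hlt _ k.2).2)
      rw [g1, g2, g3]
    · exact h b (mem_regionL'_iff.mpr ⟨hb, hd⟩)

/-! ### The dense orbit in the case of separated hooks -/

theorem exists_torus_of_hooks {n : ℕ} {S : Set (Box n)} (hS : IsUnionOfSeparatedHooks S)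
    (z : Box n → ℂˣ) : ∃ t : Torus n, ∀ b ∈ S, t.1 b.1 * (t.2 b.2)⁻¹ = z b := by
  classical
  obtain ⟨𝓗, hhook, -, hsep, rfl⟩ := hS
  have huniq : ∀ H ∈ 𝓗, ∀ K ∈ 𝓗, ∀ b ∈ H, ∀ c ∈ K, b.1 = c.1 ∨ b.2 = c.2 → H = K := by
    intro H hH K hK b hb c hc h
    by_contra hne
    exact h.elim (hsep hH hK hne b hb c hc).1 (hsep hH hK hne b hb c hc).2
  have hloc : ∀ H ∈ 𝓗, ∃ t : Torus n, ∀ b ∈ H, t.1 b.1 * (t.2 b.2)⁻¹ = z b := by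
    intro H hH
    obtain ⟨i, i', j, j', -, -, rfl⟩ := hhook H hH
    -- The column factor equals `1` at the corner column `j`, so the leg is right; on row `i` the
    -- corner value cancels.
    refine ⟨(fun r => z (r, j), fun c => z (i, j) * (z (i, c))⁻¹), ?_⟩
    rintro ⟨r, c⟩ (⟨h1, -⟩ | ⟨h1, -⟩) <;> dsimp only at h1 <;> subst h1 <;> simp
  choose! t ht using hloc
  refine ⟨(fun r => if h : ∃ H ∈ 𝓗, ∃ b ∈ H, b.1 = r then (t h.choose).1 r else 1,
    fun c => if h : ∃ H ∈ 𝓗, ∃ b ∈ H, b.2 = c then (t h.choose).2 c else 1), ?_⟩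
  rintro b ⟨H, hH, hb⟩
  have h1 : ∃ H ∈ 𝓗, ∃ c ∈ H, c.1 = b.1 := ⟨H, hH, b, hb, rfl⟩
  have h2 : ∃ H ∈ 𝓗, ∃ c ∈ H, c.2 = b.2 := ⟨H, hH, b, hb, rfl⟩
  have e1 : h1.choose = H := by
    obtain ⟨hK, c, hc, hcb⟩ := h1.choose_spec
    exact huniq _ hK _ hH c hc b hb (Or.inl hcb)
  have e2 : h2.choose = H := by
    obtain ⟨hK, c, hc, hcb⟩ := h2.choose_spec
    exact huniq _ hK _ hH c hc b hb (Or.inr hcb)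
  dsimp only
  rw [dif_pos h1, dif_pos h2, e1, e2]
  exact ht H hH b hb

/-- The matrix whose entry in a box is the number of dots of `π` weakly north-west of it. -/
noncomputable def rankMatrix {n : ℕ} (π : Equiv.Perm (Fin n)) : Matrix (Fin n) (Fin n) ℂ :=
  (Matrix.of fun i j => if j ≤ i then 1 else 0) * permutationMatrix π *
    (Matrix.of fun i j => if i ≤ j then 1 else 0)

theorem rankMatrix_mem_borelOrbit {n : ℕ} (π : Equiv.Perm (Fin n)) :
    rankMatrix π ∈ borelOrbit π := by
  refine mem_borelOrbit_iff.mpr ⟨_, _, ?_, ?_, ?_, ?_, rfl⟩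
  · intro i j hij; simp [not_le.mpr hij]
  · intro i j hij; simp [not_le.mpr hij]
  · intro i; simp
  · intro i; simp

theorem rankMatrix_apply_ne_zero {n : ℕ} {π : Equiv.Perm (Fin n)} {b : Box n}
    (hb : b ∈ regionL π) : rankMatrix π b.1 b.2 ≠ 0 := by
  have h : ¬ NoDot π b := fun h => hb.2 (mem_dominantPiece_iff.mpr h)
  simp only [NoDot, not_forall, not_lt] at h
  obtain ⟨m, hm, hπ⟩ := h
  have : rankMatrix π b.1 b.2 =
      ((Finset.univ.filter fun k => k ≤ b.2 ∧ π k ≤ b.1).card : ℂ) := by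
    rw [rankMatrix, mul_permutationMatrix_mul_apply]
    simp [Finset.card_filter, ite_and]
  rw [this, Nat.cast_ne_zero]
  exact Finset.card_ne_zero_of_mem (a := m) (by simp [hm, hπ])

theorem exists_dense_orbit {n : ℕ} {π : Equiv.Perm (Fin n)}
    (h : IsUnionOfSeparatedHooks (regionL' π)) :
    ∃ p ∈ varietyY π,
      varietyY π ⊆ zariskiClosure (Set.range fun t => quotientTorusAction (regionL π) t p) := by
  classical
  refine ⟨_, entries_mem_varietyY (rankMatrix_mem_borelOrbit π), fun y hy f hf => ?_⟩
  suffices hmem : f ∈ MvPolynomial.vanishingIdeal ℂ (varietyY π) from hmem y hy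
  have hprime := isPrime_vanishingIdeal_varietyY π
  -- The product of coordinates disposes of points with a zero coordinate. By primality it can be
  -- cancelled, being nonzero at the rank matrix.
  have hprod : f * ∏ b : regionL π, MvPolynomial.X b ∈
      MvPolynomial.vanishingIdeal ℂ (varietyY π) := by
    rw [vanishingIdeal_varietyY]
    rintro _ ⟨M, hM, rfl⟩
    rw [map_mul, map_prod]
    simp only [MvPolynomial.aeval_X]
    by_cases hz : ∃ b : regionL π, M b.1.1 b.1.2 = 0
    · obtain ⟨b, hb⟩ := hz
      rw [Finset.prod_eq_zero (Finset.mem_univ b) hb, mul_zero]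
    · push Not at hz
      obtain ⟨t, ht⟩ := exists_torus_of_hooks h fun b =>
        if hb : M b.1 b.2 ≠ 0 ∧ rankMatrix π b.1 b.2 ≠ 0 then
          Units.mk0 (M b.1 b.2) hb.1 * (Units.mk0 (rankMatrix π b.1 b.2) hb.2)⁻¹ else 1
      have heq := eq_of_eq_on_regionL' hM
        (torusMul_mem_borelOrbit (rankMatrix_mem_borelOrbit π) t) (by
          intro b hb
          have hb0 := rankMatrix_apply_ne_zero hb.1
          rw [torusMul, Matrix.of_apply, ht b hb, dif_pos ⟨hz ⟨b, hb.1⟩, hb0⟩]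
          simp [hb0])
      rw [hf _ ⟨(t : QuotientTorus n), ?_⟩, zero_mul]
      ext b
      exact (heq _ b.1 b.2.1 rfl).symm
  refine (hprime.mem_or_mem hprod).resolve_right fun hX => ?_
  have hX' := hX _ (entries_mem_varietyY (rankMatrix_mem_borelOrbit π))
  rw [map_prod] at hX'
  simp only [MvPolynomial.aeval_X] at hX'
  exact Finset.prod_ne_zero_iff.mpr (fun b _ => rankMatrix_apply_ne_zero b.2) hX'

/-! ### Rectangles obstruct dense orbits -/

theorem no_dense_orbit_of_rectangle {n : ℕ} {π : Equiv.Perm (Fin n)} {p : regionL π → ℂ}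
    (hp : varietyY π ⊆ zariskiClosure (Set.range fun t => quotientTorusAction (regionL π) t p))
    {r r' c c' : Fin n} (h11 : (r, c) ∈ regionL π) (h12 : (r, c') ∈ regionL π)
    (h21 : (r', c) ∈ regionL π) (h22 : (r', c') ∈ regionL π)
    {M : Matrix (Fin n) (Fin n) ℂ} (hM : M ∈ borelOrbit π)
    (h1 : M r c * M r' c' ≠ 0) (h0 : M r c' = 0) : False := by
  -- A zero coordinate of `p` would vanish on the whole orbit, hence on `Y_π`.
  have hne : ∀ b : regionL π, p b ≠ 0 := by
    intro b hb
    have h := hp (entries_mem_varietyY (rankMatrix_mem_borelOrbit π)) (MvPolynomial.X b) (by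
      rintro _ ⟨t, rfl⟩
      induction t using QuotientGroup.induction_on with | H t => ?_
      rw [MvPolynomial.aeval_X]
      exact (quotientTorusAction_mk_apply _ t p b).trans (by rw [hb, mul_zero]))
    rw [MvPolynomial.aeval_X] at h
    exact rankMatrix_apply_ne_zero b.2 h
  let x11 : regionL π := ⟨(r, c), h11⟩
  let x12 : regionL π := ⟨(r, c'), h12⟩
  let x21 : regionL π := ⟨(r', c), h21⟩
  let x22 : regionL π := ⟨(r', c'), h22⟩
  have h := hp (entries_mem_varietyY hM)
    (MvPolynomial.C (p x12 * p x21) * (MvPolynomial.X x11 * MvPolynomial.X x22) -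
      MvPolynomial.C (p x11 * p x22) * (MvPolynomial.X x12 * MvPolynomial.X x21)) (by
    rintro _ ⟨t, rfl⟩
    induction t using QuotientGroup.induction_on with | H t => ?_
    simp only [map_sub, map_mul, MvPolynomial.aeval_X, MvPolynomial.aeval_C,
      quotientTorusAction_mk_apply, x11, x12, x21, x22, Units.val_mul,
      Algebra.algebraMap_self, RingHom.id_apply]
    ring)
  simp only [map_sub, map_mul, MvPolynomial.aeval_X, MvPolynomial.aeval_C, entries, x11, x12, x21,
    x22, h0, zero_mul, mul_zero, sub_zero, Algebra.algebraMap_self, RingHom.id_apply] at h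
  exact mul_ne_zero (mul_ne_zero (hne x12) (hne x21)) h1 h

theorem upper_mem_borelOrbit {n : ℕ} {π : Equiv.Perm (Fin n)} {Z : Matrix (Fin n) (Fin n) ℂ}
    (hZ : ∀ i j, j < i → Z i j = 0) (hZ' : ∀ i, Z i i ≠ 0) :
    (Matrix.of fun i j => Z (π.symm i) j) ∈ borelOrbit π := by
  refine mem_borelOrbit_iff.mpr ⟨1, Z, fun i j h => Matrix.one_apply_ne h.ne, hZ, by simp, hZ', ?_⟩
  ext i j
  simp [Matrix.mul_apply, permutationMatrix, ← Equiv.eq_symm_apply]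

theorem hooks_of_dense_orbit {n : ℕ} {π : Equiv.Perm (Fin n)} {p : regionL π → ℂ}
    (hp : varietyY π ⊆ zariskiClosure (Set.range fun t => quotientTorusAction (regionL π) t p)) :
    IsUnionOfSeparatedHooks (regionL' π) := by
  have hL : ∀ m b, b ∈ dotHook π m → b ∈ regionL π := fun m b hb =>
    (dotHook_subset_regionL' π m hb).1
  refine isUnionOfSeparatedHooks_of_dots fun m m' hmm hm hm' => ?_
  have hlt : π m' < π m := by
    by_contra hle
    have hπ : π m < π m' := lt_of_le_of_ne (not_lt.mp hle) (π.injective.ne hmm.ne)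
    -- One dot is south-east of the other: the permutation matrix itself has ones on one diagonal of
    -- the rectangle and zero at its north-east corner.
    refine no_dense_orbit_of_rectangle hp (r := π m) (r' := π m') (c := m) (c' := m')
      (hL m _ ⟨hm, Or.inl ⟨rfl, le_rfl⟩⟩)
      (hL m _ ⟨northWest_mono hm' hπ.le le_rfl, Or.inl ⟨rfl, hmm.le⟩⟩)
      (hL m _ ⟨northWest_mono hm' le_rfl hmm.le, Or.inr ⟨rfl, hπ.le⟩⟩)
      (hL m' _ ⟨hm', Or.inl ⟨rfl, le_rfl⟩⟩)
      (upper_mem_borelOrbit (Z := 1) (fun i j h => Matrix.one_apply_ne h.ne') (by simp)) ?_ ?_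
    · rw [Matrix.of_apply, Matrix.of_apply, π.symm_apply_apply, π.symm_apply_apply,
        Matrix.one_apply_eq, Matrix.one_apply_eq, mul_one]
      exact one_ne_zero
    · rw [Matrix.of_apply, π.symm_apply_apply, Matrix.one_apply_ne hmm.ne]
  refine ⟨hlt, fun hnw => ?_⟩
  obtain ⟨d, hd, hd1, hd2⟩ := hnw
  dsimp only at hd1 hd2
  have hd' := mem_diagram_iff.mp hd
  -- If `d` were in column `m'`, it would lie above the dot there, yet its row is at or below `π m`,
  -- which exceeds `π m'`.
  have hl : m' < d.2 := by
    refine lt_of_le_of_ne hd2 ?_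
    rintro rfl
    exact absurd (hd'.2.trans hlt) (not_lt.mpr hd1)
  have hnd : (π m, d.2) ∈ northWest π := ⟨d, hd, hd1, le_rfl⟩
  -- The hooks cross. The added unit of `Z` puts a one at `(π m, d.2)`, opposite the dot `(π m',
  -- m')`, and leaves `(π m', d.2)` zero.
  refine no_dense_orbit_of_rectangle hp (r := π m') (r' := π m) (c := m') (c' := d.2)
    (hL m' _ ⟨hm', Or.inl ⟨rfl, le_rfl⟩⟩)
    (hL m' _ ⟨northWest_mono hnd hlt.le le_rfl, Or.inl ⟨rfl, hl.le⟩⟩)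
    (hL m _ ⟨northWest_mono hnd le_rfl hl.le, Or.inl ⟨rfl, hmm.le⟩⟩)
    (hL m _ ⟨hnd, Or.inl ⟨rfl, (hmm.trans hl).le⟩⟩)
    (upper_mem_borelOrbit (Z := 1 + Matrix.single m d.2 1) ?_ ?_) ?_ ?_
  · intro i j hij
    rw [Matrix.add_apply, Matrix.one_apply_ne hij.ne', zero_add]
    refine Matrix.single_apply_of_ne _ _ _ _ _ ?_
    rintro ⟨rfl, rfl⟩
    exact absurd hij (hmm.trans hl).not_gt
  · intro i
    rw [Matrix.add_apply, Matrix.one_apply_eq, Matrix.single_apply_of_ne, add_zero]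
    · exact one_ne_zero
    · rintro ⟨rfl, h⟩
      exact (hmm.trans hl).ne h.symm
  · rw [Matrix.of_apply, Matrix.of_apply, π.symm_apply_apply, π.symm_apply_apply]
    simp [(hmm.trans hl).ne, hmm.ne]
  · simp [Matrix.single_apply, hl.ne, hmm.ne]

end MatrixSchubert

theorem theorem3p5 (n : ℕ) (π : Equiv.Perm (Fin n)) :
    MatrixSchubert.IsToric (MatrixSchubert.varietyY π) ↔
      MatrixSchubert.IsUnionOfSeparatedHooks (MatrixSchubert.regionL' π) := by
  constructor
  · rintro ⟨-, -, -, p, -, hp⟩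
    exact MatrixSchubert.hooks_of_dense_orbit hp
  · intro h
    exact ⟨MatrixSchubert.zariskiClosure_varietyY π,
      MatrixSchubert.isPrime_vanishingIdeal_varietyY π,
      MatrixSchubert.varietyY_invariant π, MatrixSchubert.exists_dense_orbit h⟩
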